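/- Let $\Omega\subset\mathbb{R}^d$ be a compact set of positive Lebesgue measure, let $\varepsilon>0$, $N\ge 1$, and let $X=(x_1,\dots,x_N)\in(\mathbb{R}^d)^N$ satisfy $X\notin\mathcal{D}_N=\{(x_1,\dots,x_N)\mid x_i=x_j\text{ for some }i\ne j\}$. Put $\mu_X=\frac1N\sum_{i=1}^N\delta_{x_i}$. Let $\mathcal{P}_{ac}(\Omega)$ be the set of probability measures on $\Omega$ that are absolutely continuous with respect to Lebesgue measure on $\Omega$, let $H(\rho)=\int_\Omega\log\rho\,\mathrm{d}\rho\in(-\infty,+\infty]$ for $\rho\in\mathcal{P}_{ac}(\Omega)$ and $H(\rho)=+\infty$ for the other probability measures $\rho$ on $\Omega$ (Boltzmann's functional), and let $W_2$ be the quadratic Wasserstein distance between probability measures on $\mathbb{R}^d$. For $\psi\in\mathbb{R}^N$ define the Laguerre cells $$L_i(\psi)=\{x\in\Omega\mid |x-x_i|^2-\psi_i\le|x-x_j|^2-\psi_j\ \text{ for all } j\}.$$ Then there exists $\psi\in\mathbb{R}^N$ such that $$\int_{L_i(\psi)}e^{-\frac{1}{2\varepsilon}(|x-x_i|^2-\psi_i)}\,\mathrm{d}x=\frac1N\qquad\text{for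 all } i\in\{1,\dots,N\}.\tag{$*$}$$ Moreover, for every $\psi\in\mathbb{R}^N$ satisfying $(*)$, with $\phi(x)=\min_i\left(|x-x_i|^2-\psi_i\right)$ and $\sigma=e^{-\phi/(2\varepsilon)}\mathbf{1}_\Omega$, the following hold. (a) The measure with density $\sigma$ belongs to $\mathcal{P}_{ac}(\Omega)$ and is the unique minimizer of $\frac{1}{2\varepsilon}W_2^2(\cdot,\mu_X)+H(\cdot)$ over $\mathcal{P}_{ac}(\Omega)$. (b) $\frac{1}{2\varepsilon}\phi+\log\sigma=0$ on $\Omega$. (c) $(\phi,\psi)$ is a pair of optimal Kantorovich potentials in the transport from $\sigma$ to $\mu_X$ for the cost $|x-y|^2$. That is, $\phi$ is $\sigma$-integrable, $\phi(x)+\psi_i\le|x-x_i|^2$ for all $x\in\Omega$ and all $i$, the pair maximizes $\int\phi'\,\mathrm{d}\sigma+\frac1N\sum_{i=1}^N\psi'_i$ among all pairs $(\phi',\psi')$ with these two properties, and $\int\phi\,\mathrm{d}\sigma+\frac1N\sum_{i=1}^N\psi_i=W_2^2(\sigma,\mu_X)$. -/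

import Mathlib

open MeasureTheory
open scoped ENNReal

noncomputable section

namespace SemiDiscreteOT

/-- The points of `ℝ^d`, with the Euclidean norm and Lebesgue measure `volume`. -/
abbrev Pt (d : ℕ) : Type := EuclideanSpace ℝ (Fin d)

/-- The generalized diagonal: configurations of `N` points of which two coincide. -/
def generalizedDiagonal (d N : ℕ) : Set (Fin N → Pt d) :=
  {X | ∃ i j : Fin N, i ≠ j ∧ X i = X j}

/-- The empirical measure `(1/N) ∑ᵢ δ_{xᵢ}`. -/
def empiricalMeasure {d N : ℕ} (X : Fin N → Pt d) : Measure (Pt d) :=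
  (N : ℝ≥0∞)⁻¹ • ∑ i, Measure.dirac (X i)

/-- The Laguerre cell of the `i`-th point with respect to `Ω`. -/
def laguerreCell {d N : ℕ} (Ω : Set (Pt d)) (X : Fin N → Pt d) (ψ : Fin N → ℝ) (i : Fin N) :
    Set (Pt d) :=
  {x ∈ Ω | ∀ j, ‖x - X i‖ ^ 2 - ψ i ≤ ‖x - X j‖ ^ 2 - ψ j}

/-- `φ(x) = min_i (|x - xᵢ|² - ψᵢ)`; for `N ≥ 1` the infimum of this finite family is a
minimum. -/
def dualPotential {d N : ℕ} (X : Fin N → Pt d) (ψ : Fin N → ℝ) (x : Pt d) : ℝ :=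
  ⨅ i, (‖x - X i‖ ^ 2 - ψ i)

/-- The density `σ = e^{-φ/(2ε)} 1_Ω`. -/
def gibbsDensity {d : ℕ} (ε : ℝ) (Ω : Set (Pt d)) (φ : Pt d → ℝ) : Pt d → ℝ :=
  Ω.indicator fun x => Real.exp (-(φ x) / (2 * ε))

/-- The measure with density `f` with respect to Lebesgue measure. -/
def measureOfDensity {d : ℕ} (f : Pt d → ℝ) : Measure (Pt d) :=
  volume.withDensity fun x => ENNReal.ofReal (f x)

/-- Transport plans between two measures. -/
def transportPlans {d : ℕ} (μ ν : Measure (Pt d)) : Set (Measure (Pt d × Pt d)) :=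
  {γ | γ.map Prod.fst = μ ∧ γ.map Prod.snd = ν}

/-- The quadratic Wasserstein distance `W₂`, with values in `[0, ∞]`. -/
def W2 {d : ℕ} (μ ν : Measure (Pt d)) : ℝ≥0∞ :=
  (⨅ γ ∈ transportPlans μ ν, ∫⁻ p, edist p.1 p.2 ^ 2 ∂γ) ^ (1 / 2 : ℝ)

/-- Probability measures on `Ω` that are absolutely continuous with respect to Lebesgue measure
on `Ω`. They are regarded as measures on `ℝ^d` that vanish outside `Ω`. -/
def probAC {d : ℕ} (Ω : Set (Pt d)) : Set (Measure (Pt d)) :=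
  {ρ | IsProbabilityMeasure ρ ∧ ρ ≪ volume.restrict Ω}

open Classical in
/-- Boltzmann's functional: `∫_Ω log ρ dρ` if `ρ` is absolutely continuous on `Ω`, and `+∞`
otherwise. When `Ω` has finite volume, the negative part of `log ρ` is always `ρ`-integrable (as
`t log t ≥ -1/e`), so that the integral exists in `(-∞, +∞]` and non-integrability means that it
is `+∞`. -/
def boltzmann {d : ℕ} (Ω : Set (Pt d)) (ρ : Measure (Pt d)) : EReal :=
  if ρ ≪ volume.restrict Ω ∧
      Integrable (fun x => Real.log (ρ.rnDeriv (volume.restrict Ω) x).toReal) ρ then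
    ((∫ x, Real.log (ρ.rnDeriv (volume.restrict Ω) x).toReal ∂ρ : ℝ) : EReal)
  else ⊤

/-- The functional `W₂²(·, μ) / (2ε) + H`. -/
def moreauYosidaObjective {d : ℕ} (ε : ℝ) (Ω : Set (Pt d)) (μ ρ : Measure (Pt d)) : EReal :=
  ((W2 ρ μ ^ 2 / ENNReal.ofReal (2 * ε) : ℝ≥0∞) : EReal) + boltzmann Ω ρ

/-- `a` is the unique minimizer of `J` over `S`. -/
def IsUniqueMinimizer {α : Type*} (J : α → EReal) (S : Set α) (a : α) : Prop :=
  a ∈ S ∧ IsMinOn J S a ∧ ∀ b ∈ S, IsMinOn J S b → b = a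

/-- Admissible pairs in the dual of the problem of transporting `σ`, carried by `Ω`, to the
empirical measure of `X` with cost `|x - y|²`. A potential on the target is given by its values at
the points `xᵢ`. -/
def IsAdmissiblePair {d N : ℕ} (Ω : Set (Pt d)) (σ : Measure (Pt d)) (X : Fin N → Pt d)
    (φ : Pt d → ℝ) (ψ : Fin N → ℝ) : Prop :=
  Integrable φ σ ∧ ∀ x ∈ Ω, ∀ i, φ x + ψ i ≤ ‖x - X i‖ ^ 2

/-- The Kantorovich dual functional `∫ φ dσ + ∫ ψ dμ_X`. -/
def dualValue {d N : ℕ} (σ : Measure (Pt d)) (φ : Pt d → ℝ) (ψ : Fin N → ℝ) : ℝ :=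
  (∫ x, φ x ∂σ) + (1 / (N : ℝ)) * ∑ i, ψ i

/-- Optimal Kantorovich potentials: an admissible pair that maximizes the dual functional, and
whose dual value is the transport cost `W₂²(σ, μ_X)`. -/
structure IsOptimalPotentialPair {d N : ℕ} (Ω : Set (Pt d)) (σ : Measure (Pt d))
    (X : Fin N → Pt d) (φ : Pt d → ℝ) (ψ : Fin N → ℝ) : Prop where
  admissible : IsAdmissiblePair Ω σ X φ ψ
  maximal : ∀ φ' ψ', IsAdmissiblePair Ω σ X φ' ψ' → dualValue σ φ' ψ' ≤ dualValue σ φ ψ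
  value_eq : ((dualValue σ φ ψ : ℝ) : EReal) = ((W2 σ (empiricalMeasure X) ^ 2 : ℝ≥0∞) : EReal)

end SemiDiscreteOT

end

/-!
Both halves rest on one convex function of the weights,
`G ψ = 2ε ∫_Ω exp (-φ_ψ / (2ε)) - (1/N) ∑ ψᵢ`, where `φ_ψ = dualPotential X ψ`; it is
`dualFunctional` below.

*Existence.* Since the centres are distinct, the bisectors are Lebesgue-null (`volume_bisector`), and
off them the index that realizes the minimum in `φ_ψ` is locally constant in `ψ`. Differentiation
under the integral sign shows that `∂ᵢ G` is the mass of the `i`-th Laguerre cell minus `1/N`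
(`hasDerivAt_dualFunctional_update`). The function `G` is continuous, and coercive because the
exponential of the largest weight beats every linear function (`exists_norm_le_dualFunctional`);
hence it has a minimizer, and there the mass equations hold.

*Optimality.* For every `ρ` on `Ω`, the pair `(φ_ψ, ψ)` is admissible, so
`W₂² (ρ, μ_X) ≥ ∫ φ_ψ dρ + (1/N) ∑ ψᵢ` (`ofReal_dualValue_le_W2_sq`). With `σ = exp (-φ_ψ / (2ε))` the
entropy is `H ρ = KL (ρ | σ) - ∫ φ_ψ dρ / (2ε)` (`boltzmann_eq_klDiv_sub`), and adding the two gives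
`W₂² (ρ, μ_X) / (2ε) + H ρ ≥ (1/N) ∑ ψᵢ / (2ε) + KL (ρ | σ)`. If the mass equations hold, sending each
cell to its centre is a transport plan from `σ` to `μ_X` whose cost is the dual value
(`W2_sq_le_ofReal_dualValue`). This makes the potentials optimal and turns the last inequality into
an equality at `ρ = σ`; uniqueness is the equality case of Gibbs' inequality `KL (ρ | σ) ≥ 0`.
-/

namespace SemiDiscreteOT

open Filter Topology

variable {d N : ℕ}

/-! ### The dual potential and the Laguerre cells -/

theorem dualPotential_le (X : Fin N → Pt d) (ψ : Fin N → ℝ) (x : Pt d) (i : Fin N) :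
    dualPotential X ψ x ≤ ‖x - X i‖ ^ 2 - ψ i :=
  ciInf_le (Set.finite_range fun i => ‖x - X i‖ ^ 2 - ψ i).bddBelow i

theorem exists_dualPotential_eq [NeZero N] (X : Fin N → Pt d) (ψ : Fin N → ℝ) (x : Pt d) :
    ∃ i, ‖x - X i‖ ^ 2 - ψ i = dualPotential X ψ x :=
  exists_eq_ciInf_of_finite (f := fun i => ‖x - X i‖ ^ 2 - ψ i)

theorem le_dualPotential_iff [NeZero N] {X : Fin N → Pt d} {ψ : Fin N → ℝ} {x : Pt d} {a : ℝ} :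
    a ≤ dualPotential X ψ x ↔ ∀ i, a ≤ ‖x - X i‖ ^ 2 - ψ i :=
  le_ciInf_iff (Set.finite_range fun i => ‖x - X i‖ ^ 2 - ψ i).bddBelow

theorem dualPotential_eq_of_forall_le [NeZero N] {X : Fin N → Pt d} {ψ : Fin N → ℝ} {x : Pt d}
    {i : Fin N} (h : ∀ j, ‖x - X i‖ ^ 2 - ψ i ≤ ‖x - X j‖ ^ 2 - ψ j) :
    dualPotential X ψ x = ‖x - X i‖ ^ 2 - ψ i :=
  le_antisymm (dualPotential_le X ψ x i) (le_dualPotential_iff.2 h)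

theorem dualPotential_le_add [NeZero N] (X : Fin N → Pt d) {ψ ψ' : Fin N → ℝ} {r : ℝ}
    (h : ∀ i, ψ' i - ψ i ≤ r) (x : Pt d) :
    dualPotential X ψ x ≤ dualPotential X ψ' x + r := by
  obtain ⟨i, hi⟩ := exists_dualPotential_eq X ψ' x
  linarith [dualPotential_le X ψ x i, h i]

theorem continuous_dualPotential_uncurry [NeZero N] (X : Fin N → Pt d) :
    Continuous fun p : (Fin N → ℝ) × Pt d => dualPotential X p.1 p.2 := by
  have h : (fun p : (Fin N → ℝ) × Pt d => dualPotential X p.1 p.2) = fun p =>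
      Finset.univ.inf' Finset.univ_nonempty fun i => ‖p.2 - X i‖ ^ 2 - p.1 i := by
    funext p
    rw [Finset.inf'_univ_eq_ciInf]
    rfl
  rw [h]
  exact Continuous.finset_inf'_apply _ fun i _ => by fun_prop

theorem continuous_dualPotential [NeZero N] (X : Fin N → Pt d) (ψ : Fin N → ℝ) :
    Continuous (dualPotential X ψ) :=
  (continuous_dualPotential_uncurry X).comp (f := fun x => (ψ, x)) (by fun_prop)

theorem laguerreCell_subset (Ω : Set (Pt d)) (X : Fin N → Pt d) (ψ : Fin N → ℝ) (i : Fin N) :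
    laguerreCell Ω X ψ i ⊆ Ω := fun _ hx => hx.1

theorem iUnion_laguerreCell [NeZero N] (Ω : Set (Pt d)) (X : Fin N → Pt d) (ψ : Fin N → ℝ) :
    ⋃ i, laguerreCell Ω X ψ i = Ω := by
  refine subset_antisymm (Set.iUnion_subset fun i => laguerreCell_subset Ω X ψ i) fun x hx => ?_
  obtain ⟨i, hi⟩ := exists_dualPotential_eq X ψ x
  exact Set.mem_iUnion.2 ⟨i, hx, fun j => hi ▸ dualPotential_le X ψ x j⟩

theorem measurableSet_laguerreCell {Ω : Set (Pt d)} (hΩ : MeasurableSet Ω) (X : Fin N → Pt d)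
    (ψ : Fin N → ℝ) (i : Fin N) : MeasurableSet (laguerreCell Ω X ψ i) := by
  have h : laguerreCell Ω X ψ i =
      Ω ∩ ⋂ j, {x | ‖x - X i‖ ^ 2 - ψ i ≤ ‖x - X j‖ ^ 2 - ψ j} := by
    ext x
    simp [laguerreCell]
  rw [h]
  refine hΩ.inter (MeasurableSet.iInter fun j => (isClosed_le ?_ ?_).measurableSet) <;> fun_prop

/-- The points at which the weighted distances to two distinct centres agree form a hyperplane. -/
theorem volume_bisector {a b : Pt d} (hab : a ≠ b) (s t : ℝ) :
    volume {x : Pt d | ‖x - a‖ ^ 2 - s = ‖x - b‖ ^ 2 - t} = 0 := by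
  rcases Set.eq_empty_or_nonempty {x : Pt d | ‖x - a‖ ^ 2 - s = ‖x - b‖ ^ 2 - t} with h | ⟨x₀, h₀⟩
  · simp [h]
  let ℓ : Pt d →ₗ[ℝ] ℝ := (innerSL ℝ (b - a)).toLinearMap
  have hker : ∀ x, x ∈ LinearMap.ker ℓ ↔ inner ℝ (b - a) x = 0 := fun x => Iff.rfl
  have hne : AffineSubspace.mk' x₀ (LinearMap.ker ℓ) ≠ ⊤ := by
    intro htop
    have hdir := congrArg AffineSubspace.direction htop
    rw [AffineSubspace.direction_mk', AffineSubspace.direction_top] at hdir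
    have : b - a ∈ LinearMap.ker ℓ := hdir ▸ Submodule.mem_top
    rw [hker, inner_self_eq_zero, sub_eq_zero] at this
    exact hab this.symm
  refine measure_mono_null (fun x hx => ?_) (Measure.addHaar_affineSubspace volume _ hne)
  simp only [Set.mem_ofPred_eq, norm_sub_sq_real] at hx h₀
  rw [SetLike.mem_coe, AffineSubspace.mem_mk', hker, vsub_eq_sub, inner_sub_right, inner_sub_left,
    inner_sub_left, real_inner_comm x b, real_inner_comm x a, real_inner_comm x₀ b,
    real_inner_comm x₀ a]
  linarith

theorem ae_forall_ne {X : Fin N → Pt d} (hX : Function.Injective X) (ψ : Fin N → ℝ) :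
    ∀ᵐ x : Pt d, ∀ i j, i ≠ j → ‖x - X i‖ ^ 2 - ψ i ≠ ‖x - X j‖ ^ 2 - ψ j := by
  refine ae_all_iff.2 fun i => ae_all_iff.2 fun j => ?_
  by_cases hij : i = j
  · simp [hij]
  · filter_upwards [measure_eq_zero_iff_ae_notMem.1
      (volume_bisector (fun h => hij (hX h)) (ψ i) (ψ j))] with x hx _ using hx

/-! ### Solving the mass equations -/

/-- The function `ψ ↦ 2ε ∫_Ω exp (-φ_ψ / (2ε)) - (1/N) ∑ ψᵢ`: up to an additive constant, the
opposite of the concave dual of the minimization of `W₂² (·, μ_X) + 2ε H`. Its partial derivatives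
are the mass defects of the Laguerre cells. -/
noncomputable def dualFunctional (ε : ℝ) (Ω : Set (Pt d)) (X : Fin N → Pt d) (ψ : Fin N → ℝ) : ℝ :=
  2 * ε * (∫ x in Ω, Real.exp (-(dualPotential X ψ x) / (2 * ε))) - 1 / (N : ℝ) * ∑ i, ψ i

theorem continuous_dualFunctional [NeZero N] (ε : ℝ) {Ω : Set (Pt d)} (hΩ : IsCompact Ω)
    (X : Fin N → Pt d) : Continuous (dualFunctional ε Ω X) := by
  have h : Continuous (Function.uncurry fun (ψ : Fin N → ℝ) (x : Pt d) =>
      Real.exp (-(dualPotential X ψ x) / (2 * ε))) :=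
    Real.continuous_exp.comp ((continuous_dualPotential_uncurry X).neg.div_const _)
  have := continuous_parametric_integral_of_continuous (μ := volume) h hΩ
  unfold dualFunctional
  fun_prop

theorem integrableOn_exp_dualPotential [NeZero N] (ε : ℝ) {Ω : Set (Pt d)} (hΩ : IsCompact Ω)
    (X : Fin N → Pt d) (ψ : Fin N → ℝ) :
    IntegrableOn (fun x => Real.exp (-(dualPotential X ψ x) / (2 * ε))) Ω :=
  (Real.continuous_exp.comp ((continuous_dualPotential X ψ).neg.div_const _)).continuousOn
    |>.integrableOn_compact hΩ

/-- The exponential beats every linear function, here of slope `2`. -/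
theorem exists_forall_two_mul_sub_le {A ε : ℝ} (hA : 0 < A) (hε : 0 < ε) :
    ∃ C, 0 ≤ C ∧ ∀ m : ℝ, 2 * m - C ≤ A * Real.exp (m / (2 * ε)) := by
  -- The tangent line of the right-hand side has slope `2` at `m = 2 * ε * s`.
  set s := Real.log (4 * ε / A) with hs
  have hexp : A * Real.exp s = 4 * ε := by
    rw [hs, Real.exp_log (by positivity)]
    field_simp
  refine ⟨|4 * ε * (1 - s)|, abs_nonneg _, fun m => ?_⟩
  have h1 := mul_le_mul_of_nonneg_left (Real.add_one_le_exp (m / (2 * ε) - s))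
    (by positivity : (0 : ℝ) ≤ 4 * ε)
  have h2 : 4 * ε * Real.exp (m / (2 * ε) - s) = A * Real.exp (m / (2 * ε)) := by
    rw [← hexp, mul_assoc, ← Real.exp_add]
    ring_nf
  have h3 : 4 * ε * (m / (2 * ε) - s + 1) = 2 * m + 4 * ε * (1 - s) := by
    field_simp
    ring
  linarith [neg_abs_le (4 * ε * (1 - s))]

/-- The functional is coercive, with linear growth. -/
theorem exists_norm_le_dualFunctional [NeZero N] {ε : ℝ} (hε : 0 < ε) {Ω : Set (Pt d)}
    (hΩ : IsCompact Ω) (hΩpos : 0 < volume Ω) (X : Fin N → Pt d) :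
    ∃ C, ∀ ψ, ‖ψ‖ / N - C ≤ dualFunctional ε Ω X ψ := by
  have hbd : ∃ R, ∀ x ∈ Ω, ∀ j, ‖x - X j‖ ^ 2 ≤ R := by
    have hc : Continuous fun x => ∑ j, ‖x - X j‖ ^ 2 := by fun_prop
    obtain ⟨R, hR⟩ := hΩ.bddAbove_image hc.continuousOn
    exact ⟨R, fun x hx j => (Finset.single_le_sum (f := fun j => ‖x - X j‖ ^ 2)
      (fun _ _ => sq_nonneg _) (Finset.mem_univ j)).trans (hR ⟨x, hx, rfl⟩)⟩
  obtain ⟨R, hR⟩ := hbd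
  have hV : 0 < volume.real Ω := ENNReal.toReal_pos hΩpos.ne' hΩ.measure_lt_top.ne
  obtain ⟨C, hC0, hC⟩ := exists_forall_two_mul_sub_le
    (A := 2 * ε * (volume.real Ω * Real.exp (-R / (2 * ε)))) (by positivity) hε
  have hNpos : (0 : ℝ) < N := Nat.cast_pos.2 (NeZero.pos N)
  have hN1 : (1 : ℝ) ≤ N := Nat.one_le_cast.2 (NeZero.pos N)
  refine ⟨C, fun ψ => ?_⟩
  -- The largest weight `ψ k` bounds the exponential term from below; the mean term controls the
  -- gaps `ψ k - ψ i`.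
  obtain ⟨k, hk⟩ := Finite.exists_max ψ
  have hint : volume.real Ω * Real.exp ((ψ k - R) / (2 * ε)) ≤
      ∫ x in Ω, Real.exp (-(dualPotential X ψ x) / (2 * ε)) := by
    have h := setIntegral_mono_on (μ := volume)
      (integrableOn_const (C := Real.exp ((ψ k - R) / (2 * ε))) hΩ.measure_lt_top.ne)
      (integrableOn_exp_dualPotential ε hΩ X ψ) hΩ.measurableSet (fun x hx => by
        gcongr
        linarith [dualPotential_le X ψ x k, hR x hx k])
    simpa using h
  have hexp : 2 * ε * (volume.real Ω * Real.exp (-R / (2 * ε))) * Real.exp (ψ k / (2 * ε)) =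
      2 * ε * (volume.real Ω * Real.exp ((ψ k - R) / (2 * ε))) := by
    rw [sub_div, neg_div, sub_eq_add_neg, Real.exp_add]
    ring
  have hE := mul_le_mul_of_nonneg_left hint (by positivity : 0 ≤ 2 * ε)
  have hE2 := hC (ψ k)
  have hE0 : 0 ≤ 2 * ε * (volume.real Ω * Real.exp (-R / (2 * ε))) * Real.exp (ψ k / (2 * ε)) := by
    positivity
  rw [hexp] at hE2 hE0
  have habs : |ψ k| - C ≤
      2 * ε * (∫ x in Ω, Real.exp (-(dualPotential X ψ x) / (2 * ε))) - ψ k := by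
    rcases abs_cases (ψ k) with ⟨h, _⟩ | ⟨h, _⟩ <;> rw [h] <;> linarith
  have hcoord : ∀ i, |ψ i| / N - C ≤ dualFunctional ε Ω X ψ := by
    intro i
    have hsum : ψ k - ψ i ≤ ∑ j, (ψ k - ψ j) :=
      Finset.single_le_sum (f := fun j => ψ k - ψ j) (fun j _ => sub_nonneg.2 (hk j))
        (Finset.mem_univ i)
    have hmean : (ψ k - ψ i) / N ≤ ψ k - 1 / (N : ℝ) * ∑ j, ψ j := by
      rw [Finset.sum_sub_distrib, Finset.sum_const, Finset.card_univ, Fintype.card_fin,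
        nsmul_eq_mul] at hsum
      rw [div_le_iff₀ hNpos]
      calc ψ k - ψ i ≤ N * ψ k - ∑ j, ψ j := hsum
        _ = _ := by field_simp
    have htri : |ψ i| ≤ |ψ k| + (ψ k - ψ i) := by
      have h := abs_sub (ψ k) (ψ k - ψ i)
      rwa [sub_sub_cancel, abs_of_nonneg (sub_nonneg.2 (hk i))] at h
    have h1 : |ψ i| / N ≤ |ψ k| / N + (ψ k - ψ i) / N := by
      rw [← add_div]
      gcongr
    have h2 : |ψ k| / N ≤ |ψ k| := div_le_self (abs_nonneg _) hN1
    unfold dualFunctional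
    linarith
  have h0 : 0 ≤ N * (dualFunctional ε Ω X ψ + C) := by
    have := hcoord k
    have h' : 0 ≤ |ψ k| / N := by positivity
    exact mul_nonneg hNpos.le (by linarith)
  have hnorm : ‖ψ‖ ≤ N * (dualFunctional ε Ω X ψ + C) := by
    refine (pi_norm_le_iff_of_nonneg h0).2 fun i => ?_
    have := hcoord i
    rw [Real.norm_eq_abs, mul_comm, ← div_le_iff₀ hNpos]
    linarith
  have := (div_le_iff₀ hNpos).2 (hnorm.trans_eq (mul_comm _ _))
  linarith

theorem abs_exp_sub_exp_le {a b c : ℝ} (ha : a ≤ c) (hb : b ≤ c) :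
    |Real.exp a - Real.exp b| ≤ Real.exp c * |a - b| := by
  wlog hab : b ≤ a generalizing a b
  · rw [abs_sub_comm, abs_sub_comm a]
    exact this hb ha (le_of_not_ge hab)
  rw [abs_of_nonneg (sub_nonneg.2 (Real.exp_le_exp.2 hab)), abs_of_nonneg (sub_nonneg.2 hab)]
  have h1 : Real.exp a - Real.exp b = Real.exp a * (1 - Real.exp (b - a)) := by
    rw [mul_sub, ← Real.exp_add]
    simp
  rw [h1]
  have h2 := Real.add_one_le_exp (b - a)
  have h3 : 0 ≤ a - b := sub_nonneg.2 hab
  calc Real.exp a * (1 - Real.exp (b - a)) ≤ Real.exp a * (a - b) :=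
        mul_le_mul_of_nonneg_left (by linarith) (Real.exp_pos a).le
    _ ≤ _ := by gcongr

/-- At a point lying on no bisector, the minimizing index is locally constant in `ψ`. -/
theorem hasDerivAt_exp_dualPotential_update [NeZero N] {ε : ℝ} (Ω : Set (Pt d))
    (X : Fin N → Pt d) (ψ : Fin N → ℝ) (i : Fin N) {x : Pt d} (hxΩ : x ∈ Ω)
    (hx : ∀ i j, i ≠ j → ‖x - X i‖ ^ 2 - ψ i ≠ ‖x - X j‖ ^ 2 - ψ j) :
    HasDerivAt (fun t => Real.exp (-(dualPotential X (Function.update ψ i t) x) / (2 * ε)))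
      ((laguerreCell Ω X ψ i).indicator
        (fun x => Real.exp (-(‖x - X i‖ ^ 2 - ψ i) / (2 * ε)) / (2 * ε)) x) (ψ i) := by
  obtain ⟨k, hk⟩ := exists_dualPotential_eq X ψ x
  have hlt : ∀ j, j ≠ k → ‖x - X k‖ ^ 2 - ψ k < ‖x - X j‖ ^ 2 - ψ j := fun j hj =>
    lt_of_le_of_ne (hk ▸ dualPotential_le X ψ x j) (hx k j hj.symm)
  have hev : ∀ᶠ t in 𝓝 (ψ i), dualPotential X (Function.update ψ i t) x =
      ‖x - X k‖ ^ 2 - Function.update ψ i t k := by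
    have hcont : ∀ j, Continuous fun t : ℝ => ‖x - X j‖ ^ 2 - Function.update ψ i t j := fun j =>
      continuous_const.sub
        ((continuous_apply (A := fun _ : Fin N => ℝ) j).comp
          ((continuous_const (y := ψ)).update i continuous_id))
    have : ∀ᶠ t in 𝓝 (ψ i), ∀ j, j ≠ k → ‖x - X k‖ ^ 2 - Function.update ψ i t k <
        ‖x - X j‖ ^ 2 - Function.update ψ i t j := by
      refine eventually_all.2 fun j => ?_
      by_cases hj : j = k
      · simp [hj]
      · have := ((hcont k).tendsto (ψ i)).eventually_lt ((hcont j).tendsto (ψ i))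
          (by simpa using hlt j hj)
        exact this.mono fun t ht _ => ht
    filter_upwards [this] with t ht
    refine dualPotential_eq_of_forall_le fun j => ?_
    by_cases hj : j = k
    · rw [hj]
    · exact (ht j hj).le
  refine HasDerivAt.congr_of_eventuallyEq ?_
    (hev.mono fun t ht => congrArg (fun y => Real.exp (-y / (2 * ε))) ht)
  by_cases hki : k = i
  · subst hki
    have hmem : x ∈ laguerreCell Ω X ψ k := ⟨hxΩ, fun j => hk ▸ dualPotential_le X ψ x j⟩
    rw [Set.indicator_of_mem hmem]
    have h := (((hasDerivAt_id (ψ k)).const_sub (‖x - X k‖ ^ 2)).neg.div_const (2 * ε)).exp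
    refine (h.congr_of_eventuallyEq (Eventually.of_forall fun t => by simp)).congr_deriv ?_
    simp [div_eq_mul_inv]
  · have hmem : x ∉ laguerreCell Ω X ψ i := fun h => (hlt i (Ne.symm hki)).not_ge (h.2 k)
    rw [Set.indicator_of_notMem hmem]
    exact (hasDerivAt_const (ψ i) (Real.exp (-(‖x - X k‖ ^ 2 - ψ k) / (2 * ε)))).congr_of_eventuallyEq
      (Eventually.of_forall fun t => by simp [hki])

/-- The partial derivatives of `dualFunctional` are the mass defects of the Laguerre cells. -/
theorem hasDerivAt_dualFunctional_update [NeZero N] {ε : ℝ} (hε : 0 < ε) {Ω : Set (Pt d)}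
    (hΩ : IsCompact Ω) {X : Fin N → Pt d} (hX : Function.Injective X) (ψ : Fin N → ℝ)
    (i : Fin N) :
    HasDerivAt (fun t => dualFunctional ε Ω X (Function.update ψ i t))
      ((∫ x in laguerreCell Ω X ψ i, Real.exp (-(‖x - X i‖ ^ 2 - ψ i) / (2 * ε))) - 1 / (N : ℝ))
      (ψ i) := by
  have hcell := measurableSet_laguerreCell hΩ.measurableSet X ψ i
  have hupd : ∀ s t : ℝ, ∀ j, Function.update ψ i s j - Function.update ψ i t j ≤ |s - t| := by
    intro s t j
    by_cases hj : j = i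
    · subst hj
      simpa using le_abs_self (s - t)
    · simp [Function.update_of_ne hj]
  -- On the unit ball around `ψ i` the potential drops by at most `1`, which gives a uniform
  -- Lipschitz bound for the integrand.
  have hmain := hasDerivAt_integral_of_dominated_loc_of_lip (μ := volume.restrict Ω)
    (F := fun t x => Real.exp (-(dualPotential X (Function.update ψ i t) x) / (2 * ε)))
    (F' := (laguerreCell Ω X ψ i).indicator
        (fun x => Real.exp (-(‖x - X i‖ ^ 2 - ψ i) / (2 * ε)) / (2 * ε)))
    (bound := fun x => Real.exp (-(dualPotential X ψ x - 1) / (2 * ε)) / (2 * ε))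
    (s := Metric.ball (ψ i) 1) (x₀ := ψ i) (Metric.ball_mem_nhds _ one_pos)
    (Eventually.of_forall fun t =>
      (integrableOn_exp_dualPotential ε hΩ X (Function.update ψ i t)).aestronglyMeasurable)
    (integrableOn_exp_dualPotential ε hΩ X _)
    (Measurable.aestronglyMeasurable
      (Measurable.indicator (Continuous.measurable (by fun_prop)) hcell))
    (ae_of_all _ fun x => by
      refine LipschitzOnWith.of_dist_le_mul fun s hs t ht => ?_
      have hb : ∀ u ∈ Metric.ball (ψ i) 1,
          -(dualPotential X (Function.update ψ i u) x) / (2 * ε) ≤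
            -(dualPotential X ψ x - 1) / (2 * ε) := fun u hu => by
        have h := dualPotential_le_add X (hupd u (ψ i)) x
        rw [Function.update_eq_self] at h
        have h1 : |u - ψ i| < 1 := hu
        gcongr
        linarith
      rw [Real.dist_eq, Real.dist_eq, Real.coe_nnabs,
        abs_of_pos (a := Real.exp (-(dualPotential X ψ x - 1) / (2 * ε)) / (2 * ε)) (by positivity)]
      refine (abs_exp_sub_exp_le (hb s hs) (hb t ht)).trans ?_
      have h1 := dualPotential_le_add X (hupd s t) x
      have h2 := dualPotential_le_add X (hupd t s) x
      rw [abs_sub_comm t s] at h2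
      have h3 : |-dualPotential X (Function.update ψ i s) x -
          -dualPotential X (Function.update ψ i t) x| ≤ |s - t| :=
        abs_le.2 ⟨by linarith, by linarith⟩
      rw [div_mul_eq_mul_div, mul_div_assoc, ← sub_div, abs_div,
        abs_of_pos (by positivity : 0 < 2 * ε)]
      gcongr)
    ((Real.continuous_exp.comp (((continuous_dualPotential X ψ).sub continuous_const).neg.div_const
      _)).div_const _ |>.continuousOn.integrableOn_compact hΩ)
    ((ae_restrict_mem hΩ.measurableSet).mp ((ae_restrict_of_ae (ae_forall_ne hX ψ)).mono
      fun x hx hxΩ => hasDerivAt_exp_dualPotential_update Ω X ψ i hxΩ hx))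
  have hsum : HasDerivAt (fun t => ∑ j, Function.update ψ i t j) 1 (ψ i) := by
    have h : (fun t => ∑ j, Function.update ψ i t j) =
        fun t => t + ∑ j ∈ Finset.univ \ {i}, ψ j := by
      funext t
      rw [Finset.sum_update_of_mem (Finset.mem_univ i)]
    rw [h]
    exact (hasDerivAt_id _).add_const _
  refine ((hmain.2.const_mul (2 * ε)).sub (hsum.const_mul (1 / (N : ℝ)))).congr_deriv ?_
  rw [setIntegral_indicator hcell,
    Set.inter_eq_self_of_subset_right (laguerreCell_subset Ω X ψ i), integral_div, mul_one]
  field_simp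

/-- A minimizer of `dualFunctional` solves the mass equations. -/
theorem exists_forall_setIntegral_laguerreCell_eq [NeZero N] {ε : ℝ} (hε : 0 < ε) {Ω : Set (Pt d)}
    (hΩ : IsCompact Ω) (hΩpos : 0 < volume Ω) {X : Fin N → Pt d} (hX : Function.Injective X) :
    ∃ ψ : Fin N → ℝ, ∀ i, ∫ x in laguerreCell Ω X ψ i,
      Real.exp (-(‖x - X i‖ ^ 2 - ψ i) / (2 * ε)) = 1 / (N : ℝ) := by
  obtain ⟨C, hC⟩ := exists_norm_le_dualFunctional hε hΩ hΩpos X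
  have hNpos : (0 : ℝ) < N := Nat.cast_pos.2 (NeZero.pos N)
  have htend : Tendsto (dualFunctional ε Ω X) (cocompact _) atTop :=
    tendsto_atTop_mono hC (tendsto_atTop_add_const_right _ (-C)
      ((tendsto_norm_cocompact_atTop).atTop_div_const hNpos))
  obtain ⟨ψ, hψ⟩ := (continuous_dualFunctional ε hΩ X).exists_forall_le htend
  refine ⟨ψ, fun i => ?_⟩
  have hmin : IsLocalMin (fun t => dualFunctional ε Ω X (Function.update ψ i t)) (ψ i) :=
    Eventually.of_forall fun t => by simpa using hψ _
  exact sub_eq_zero.1 (hmin.hasDerivAt_eq_zero (hasDerivAt_dualFunctional_update hε hΩ hX ψ i))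

/-! ### Semi-discrete Kantorovich duality -/

theorem W2_sq (μ ν : Measure (Pt d)) :
    W2 μ ν ^ 2 = ⨅ γ ∈ transportPlans μ ν, ∫⁻ p, edist p.1 p.2 ^ 2 ∂γ := by
  rw [W2, ← ENNReal.rpow_natCast, ← ENNReal.rpow_mul]
  norm_num

theorem edist_sq (x y : Pt d) : edist x y ^ 2 = ENNReal.ofReal (‖x - y‖ ^ 2) := by
  rw [edist_dist, dist_eq_norm, ENNReal.ofReal_pow (norm_nonneg _)]

theorem ofReal_integral_le_lintegral_ofReal {α : Type*} [MeasurableSpace α] {μ : Measure α}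
    {f : α → ℝ} (hf : Integrable f μ) :
    ENNReal.ofReal (∫ x, f x ∂μ) ≤ ∫⁻ x, ENNReal.ofReal (f x) ∂μ := by
  calc ENNReal.ofReal (∫ x, f x ∂μ) ≤ ENNReal.ofReal (∫ x, max (f x) 0 ∂μ) :=
        ENNReal.ofReal_le_ofReal (integral_mono hf hf.pos_part fun x => le_max_left _ _)
    _ = ∫⁻ x, ENNReal.ofReal (max (f x) 0) ∂μ :=
        ofReal_integral_eq_lintegral_ofReal hf.pos_part (ae_of_all _ fun x => le_max_right _ _)
    _ = _ := by simp

theorem ae_empiricalMeasure (X : Fin N → Pt d) {p : Pt d → Prop} (h : ∀ i, p (X i)) :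
    ∀ᵐ y ∂empiricalMeasure X, p y := by
  refine Measure.ae_smul_measure ?_ _
  rw [← Measure.sum_fintype, Measure.ae_sum_iff]
  intro i
  rw [ae_dirac_eq]
  exact h i

theorem integrable_empiricalMeasure [NeZero N] (X : Fin N → Pt d) (f : Pt d → ℝ) :
    Integrable f (empiricalMeasure X) := by
  refine Integrable.smul_measure (integrable_finsetSum_measure.2 fun i _ => ?_)
    (ENNReal.inv_ne_top.2 (Nat.cast_ne_zero.2 (NeZero.ne N)))
  exact integrable_dirac (by simp)

theorem integral_empiricalMeasure (X : Fin N → Pt d) (f : Pt d → ℝ) :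
    ∫ y, f y ∂empiricalMeasure X = 1 / (N : ℝ) * ∑ i, f (X i) := by
  rw [empiricalMeasure, integral_smul_measure, integral_finsetSum_measure fun i _ =>
    integrable_dirac (by simp)]
  simp

/-- Weak duality: the dual value of an admissible pair bounds the transport cost from below. -/
theorem ofReal_dualValue_le_W2_sq [NeZero N] {Ω : Set (Pt d)} {ρ : Measure (Pt d)}
    (hρ : ∀ᵐ x ∂ρ, x ∈ Ω) {X : Fin N → Pt d} (hX : Function.Injective X) {φ : Pt d → ℝ}
    {ψ : Fin N → ℝ} (h : IsAdmissiblePair Ω ρ X φ ψ) :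
    ENNReal.ofReal (dualValue ρ φ ψ) ≤ W2 ρ (empiricalMeasure X) ^ 2 := by
  rw [W2_sq]
  refine le_iInf₂ fun γ hγ => ?_
  -- `ψ` is defined at the points of the configuration only; here it is extended by zero.
  set ψ' : Pt d → ℝ := Function.extend X ψ 0 with hψ'
  have hψ'X : ∀ i, ψ' (X i) = ψ i := fun i => hX.extend_apply ψ 0 i
  have hφ : Integrable (fun p : Pt d × Pt d => φ p.1) γ :=
    Integrable.comp_measurable (f := Prod.fst) (by rw [hγ.1]; exact h.1) measurable_fst
  have hψ : Integrable (fun p : Pt d × Pt d => ψ' p.2) γ :=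
    Integrable.comp_measurable (f := Prod.snd)
      (by rw [hγ.2]; exact integrable_empiricalMeasure X ψ') measurable_snd
  have hval : dualValue ρ φ ψ = ∫ p, (φ p.1 + ψ' p.2) ∂γ := by
    rw [integral_add hφ hψ, dualValue, ← hγ.1,
      integral_map measurable_fst.aemeasurable (by rw [hγ.1]; exact h.1.aestronglyMeasurable),
      ← integral_map (f := ψ') measurable_snd.aemeasurable
        (by rw [hγ.2]; exact (integrable_empiricalMeasure X ψ').aestronglyMeasurable), hγ.2,
      integral_empiricalMeasure]
    simp [hψ'X]
  have hfst : ∀ᵐ p ∂γ, p.1 ∈ Ω :=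
    ae_of_ae_map measurable_fst.aemeasurable (by rw [hγ.1]; exact hρ)
  have hsnd : ∀ᵐ p ∂γ, ∃ i, p.2 = X i :=
    ae_of_ae_map (p := fun y => ∃ i, y = X i) measurable_snd.aemeasurable
      (by rw [hγ.2]; exact ae_empiricalMeasure X fun i => ⟨i, rfl⟩)
  rw [hval]
  refine (ofReal_integral_le_lintegral_ofReal (hφ.add hψ)).trans (lintegral_mono_ae ?_)
  filter_upwards [hfst, hsnd] with p hp₁ ⟨i, hi⟩
  rw [edist_sq, hi]
  refine ENNReal.ofReal_le_ofReal ?_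
  simp only [Pi.add_apply, hi, hψ'X]
  exact h.2 p.1 hp₁ i

theorem aedisjoint_laguerreCell (Ω : Set (Pt d)) {X : Fin N → Pt d} (hX : Function.Injective X)
    (ψ : Fin N → ℝ) :
    Pairwise fun i j => AEDisjoint volume (laguerreCell Ω X ψ i) (laguerreCell Ω X ψ j) :=
  fun i j hij => measure_mono_null (fun _ hx => le_antisymm (hx.1.2 j) (hx.2.2 i))
    (volume_bisector (fun h => hij (hX h)) (ψ i) (ψ j))

theorem sum_restrict_laguerreCell [NeZero N] {Ω : Set (Pt d)} (hΩ : MeasurableSet Ω)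
    {ρ : Measure (Pt d)} (hρ : ρ ≪ volume.restrict Ω) {X : Fin N → Pt d}
    (hX : Function.Injective X) (ψ : Fin N → ℝ) :
    ∑ i, ρ.restrict (laguerreCell Ω X ψ i) = ρ := by
  rw [← Measure.sum_fintype, ← Measure.restrict_iUnion_ae, iUnion_laguerreCell,
    Measure.restrict_eq_self_of_ae_mem (hρ.ae_le (ae_restrict_mem hΩ))]
  · exact fun i j hij => (hρ.trans Measure.restrict_le_self.absolutelyContinuous)
      (aedisjoint_laguerreCell Ω hX ψ hij)
  · exact fun i => (measurableSet_laguerreCell hΩ X ψ i).nullMeasurableSet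

theorem setIntegral_laguerreCell_sq [NeZero N] {Ω : Set (Pt d)} (hΩ : MeasurableSet Ω)
    {ρ : Measure (Pt d)} [IsFiniteMeasure ρ] {X : Fin N → Pt d} {ψ : Fin N → ℝ}
    (hmass : ∀ i, ρ (laguerreCell Ω X ψ i) = (N : ℝ≥0∞)⁻¹)
    (hint : Integrable (dualPotential X ψ) ρ) (i : Fin N) :
    IntegrableOn (fun x => ‖x - X i‖ ^ 2) (laguerreCell Ω X ψ i) ρ ∧
      ∫ x in laguerreCell Ω X ψ i, ‖x - X i‖ ^ 2 ∂ρ =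
        (∫ x in laguerreCell Ω X ψ i, dualPotential X ψ x ∂ρ) + 1 / (N : ℝ) * ψ i := by
  have heq : (fun x => dualPotential X ψ x + ψ i) =ᵐ[ρ.restrict (laguerreCell Ω X ψ i)]
      fun x => ‖x - X i‖ ^ 2 := by
    filter_upwards [ae_restrict_mem (measurableSet_laguerreCell hΩ X ψ i)] with x hx
    rw [dualPotential_eq_of_forall_le hx.2]
    ring
  refine ⟨(hint.restrict.add (integrable_const (ψ i))).congr heq, ?_⟩
  rw [← integral_congr_ae heq, integral_add hint.restrict (integrable_const _)]
  simp [measureReal_def, hmass]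

theorem dualValue_dualPotential_eq_sum [NeZero N] {Ω : Set (Pt d)} (hΩ : MeasurableSet Ω)
    {ρ : Measure (Pt d)} [IsFiniteMeasure ρ] (hρ : ρ ≪ volume.restrict Ω) {X : Fin N → Pt d}
    (hX : Function.Injective X) {ψ : Fin N → ℝ}
    (hmass : ∀ i, ρ (laguerreCell Ω X ψ i) = (N : ℝ≥0∞)⁻¹)
    (hint : Integrable (dualPotential X ψ) ρ) :
    dualValue ρ (dualPotential X ψ) ψ =
      ∑ i, ∫ x in laguerreCell Ω X ψ i, ‖x - X i‖ ^ 2 ∂ρ := by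
  rw [Finset.sum_congr rfl fun i _ => (setIntegral_laguerreCell_sq hΩ hmass hint i).2,
    Finset.sum_add_distrib, ← Finset.mul_sum,
    ← integral_finsetSum_measure fun i _ => hint.restrict,
    sum_restrict_laguerreCell hΩ hρ hX ψ, dualValue]

/-- When the cells have equal masses, sending each Laguerre cell to its centre is a transport plan,
and on each cell the constraint `φ + ψᵢ ≤ |x - xᵢ|²` is an equality. -/
theorem W2_sq_le_ofReal_dualValue [NeZero N] {Ω : Set (Pt d)} (hΩ : IsCompact Ω)
    {ρ : Measure (Pt d)} [IsFiniteMeasure ρ] (hρ : ρ ≪ volume.restrict Ω) {X : Fin N → Pt d}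
    (hX : Function.Injective X) {ψ : Fin N → ℝ}
    (hmass : ∀ i, ρ (laguerreCell Ω X ψ i) = (N : ℝ≥0∞)⁻¹)
    (hint : Integrable (dualPotential X ψ) ρ) :
    W2 ρ (empiricalMeasure X) ^ 2 ≤ ENNReal.ofReal (dualValue ρ (dualPotential X ψ) ψ) := by
  have hdec := sum_restrict_laguerreCell hΩ.measurableSet hρ hX ψ
  have hmeas : ∀ i, Measurable fun x : Pt d => (x, X i) := fun i => by fun_prop
  set γ : Measure (Pt d × Pt d) :=
    ∑ i, (ρ.restrict (laguerreCell Ω X ψ i)).map fun x => (x, X i) with hγ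
  have hplan : γ ∈ transportPlans ρ (empiricalMeasure X) := by
    constructor
    · conv_rhs => rw [← hdec]
      ext s hs
      rw [Measure.map_apply measurable_fst hs, hγ, Measure.finsetSum_apply,
        Measure.finsetSum_apply]
      refine Finset.sum_congr rfl fun i _ => ?_
      rw [Measure.map_apply (hmeas i) (measurable_fst hs)]
      rfl
    · ext s hs
      rw [Measure.map_apply measurable_snd hs, hγ, Measure.finsetSum_apply, empiricalMeasure,
        Measure.smul_apply, Measure.finsetSum_apply, Finset.smul_sum]
      refine Finset.sum_congr rfl fun i _ => ?_
      rw [Measure.map_apply (hmeas i) (measurable_snd hs), Measure.dirac_apply' _ hs]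
      by_cases hi : X i ∈ s
      · have : (fun x : Pt d => (x, X i)) ⁻¹' (Prod.snd ⁻¹' s) = Set.univ := by ext; simp [hi]
        simp [this, hi, hmass]
      · have : (fun x : Pt d => (x, X i)) ⁻¹' (Prod.snd ⁻¹' s) = ∅ := by ext; simp [hi]
        simp [this, hi]
  rw [W2_sq]
  refine (iInf₂_le γ hplan).trans_eq ?_
  rw [hγ, lintegral_finsetSum_measure,
    dualValue_dualPotential_eq_sum hΩ.measurableSet hρ hX hmass hint,
    ENNReal.ofReal_sum_of_nonneg fun i _ => integral_nonneg fun x => sq_nonneg _]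
  refine Finset.sum_congr rfl fun i _ => ?_
  rw [lintegral_map (by fun_prop) (hmeas i), ofReal_integral_eq_lintegral_ofReal
    (setIntegral_laguerreCell_sq hΩ.measurableSet hmass hint i).1 (ae_of_all _ fun x => sq_nonneg _)]
  simp only [edist_sq]

theorem isOptimalPotentialPair_dualPotential [NeZero N] {Ω : Set (Pt d)} (hΩ : IsCompact Ω)
    {ρ : Measure (Pt d)} [IsFiniteMeasure ρ] (hρ : ρ ≪ volume.restrict Ω) {X : Fin N → Pt d}
    (hX : Function.Injective X) {ψ : Fin N → ℝ}
    (hmass : ∀ i, ρ (laguerreCell Ω X ψ i) = (N : ℝ≥0∞)⁻¹)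
    (hint : Integrable (dualPotential X ψ) ρ) :
    IsOptimalPotentialPair Ω ρ X (dualPotential X ψ) ψ := by
  have hmem : ∀ᵐ x ∂ρ, x ∈ Ω := hρ.ae_le (ae_restrict_mem hΩ.measurableSet)
  have hadm : IsAdmissiblePair Ω ρ X (dualPotential X ψ) ψ :=
    ⟨hint, fun x _ i => by linarith [dualPotential_le X ψ x i]⟩
  have hW := le_antisymm (W2_sq_le_ofReal_dualValue hΩ hρ hX hmass hint)
    (ofReal_dualValue_le_W2_sq hmem hX hadm)
  have hpos : 0 ≤ dualValue ρ (dualPotential X ψ) ψ := by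
    rw [dualValue_dualPotential_eq_sum hΩ.measurableSet hρ hX hmass hint]
    exact Finset.sum_nonneg fun i _ => integral_nonneg fun x => sq_nonneg _
  refine ⟨hadm, fun φ' ψ' h' => ?_, ?_⟩
  · have := ofReal_dualValue_le_W2_sq hmem hX h'
    rwa [hW, ENNReal.ofReal_le_ofReal_iff hpos] at this
  · rw [hW, EReal.coe_ennreal_ofReal, max_eq_left hpos]

/-! ### Entropy and relative entropy -/

theorem measureOfDensity_gibbsDensity (ε : ℝ) {Ω : Set (Pt d)} (hΩ : MeasurableSet Ω)
    (φ : Pt d → ℝ) : measureOfDensity (gibbsDensity ε Ω φ) =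
      (volume.restrict Ω).withDensity fun x => ENNReal.ofReal (Real.exp (-(φ x) / (2 * ε))) := by
  rw [← withDensity_indicator hΩ, measureOfDensity]
  congr 1
  funext x
  by_cases hx : x ∈ Ω <;> simp [gibbsDensity, hx]

theorem log_gibbsDensity {ε : ℝ} {Ω : Set (Pt d)} (φ : Pt d → ℝ) {x : Pt d} (hx : x ∈ Ω) :
    Real.log (gibbsDensity ε Ω φ x) = -(φ x) / (2 * ε) := by
  rw [gibbsDensity, Set.indicator_of_mem hx, Real.log_exp]

theorem isProbabilityMeasure_of_laguerreCell [NeZero N] {Ω : Set (Pt d)} (hΩ : MeasurableSet Ω)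
    {ρ : Measure (Pt d)} (hρ : ρ ≪ volume.restrict Ω) {X : Fin N → Pt d}
    (hX : Function.Injective X) {ψ : Fin N → ℝ}
    (hmass : ∀ i, ρ (laguerreCell Ω X ψ i) = (N : ℝ≥0∞)⁻¹) : IsProbabilityMeasure ρ := by
  constructor
  rw [← sum_restrict_laguerreCell hΩ hρ hX ψ, Measure.finsetSum_apply]
  simp [hmass, ENNReal.mul_inv_cancel, NeZero.ne N]

theorem measureOfDensity_gibbsDensity_laguerreCell [NeZero N] (ε : ℝ) {Ω : Set (Pt d)}
    (hΩ : IsCompact Ω) {X : Fin N → Pt d} {ψ : Fin N → ℝ} {i : Fin N}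
    (h : ∫ x in laguerreCell Ω X ψ i, Real.exp (-(‖x - X i‖ ^ 2 - ψ i) / (2 * ε)) = 1 / (N : ℝ)) :
    measureOfDensity (gibbsDensity ε Ω (dualPotential X ψ)) (laguerreCell Ω X ψ i) =
      (N : ℝ≥0∞)⁻¹ := by
  have hcell := measurableSet_laguerreCell hΩ.measurableSet X ψ i
  have hsub := laguerreCell_subset Ω X ψ i
  rw [measureOfDensity_gibbsDensity ε hΩ.measurableSet, withDensity_apply _ hcell,
    Measure.restrict_restrict hcell, Set.inter_eq_self_of_subset_left hsub,
    ← ofReal_integral_eq_lintegral_ofReal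
      ((integrableOn_exp_dualPotential ε hΩ X ψ).mono_set hsub)
      (ae_of_all _ fun x => (Real.exp_pos _).le),
    setIntegral_congr_fun (g := fun x => Real.exp (-(‖x - X i‖ ^ 2 - ψ i) / (2 * ε))) hcell
      fun x hx => by simp only [dualPotential_eq_of_forall_le hx.2], h, one_div,
    ENNReal.ofReal_inv_of_pos (Nat.cast_pos.2 (NeZero.pos N)), ENNReal.ofReal_natCast]

theorem integrable_of_continuous_of_absolutelyContinuous {Ω : Set (Pt d)} (hΩ : IsCompact Ω)
    {ρ : Measure (Pt d)} [IsFiniteMeasure ρ] (hρ : ρ ≪ volume.restrict Ω) {φ : Pt d → ℝ}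
    (hφ : Continuous φ) : Integrable φ ρ := by
  have h := hφ.continuousOn.integrableOn_compact (μ := ρ) hΩ
  rwa [IntegrableOn,
    Measure.restrict_eq_self_of_ae_mem (hρ.ae_le (ae_restrict_mem hΩ.measurableSet))] at h

/-- Relative to a Gibbs measure, the log-likelihood ratio is the sum of the logarithm of the
density and of the potential; this identifies the free energy with a relative entropy. -/
theorem llr_gibbs_ae_eq (ε : ℝ) {Ω : Set (Pt d)} {ρ : Measure (Pt d)} [IsFiniteMeasure ρ]
    (hρ : ρ ≪ volume.restrict Ω) {φ : Pt d → ℝ} (hφ : Continuous φ) :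
    llr ρ ((volume.restrict Ω).withDensity fun x => ENNReal.ofReal (Real.exp (-(φ x) / (2 * ε))))
      =ᵐ[ρ] fun x => Real.log (ρ.rnDeriv (volume.restrict Ω) x).toReal + φ x / (2 * ε) := by
  have hmeas := hφ.measurable
  have h := Measure.rnDeriv_withDensity_right ρ (volume.restrict Ω)
    (f := fun x => ENNReal.ofReal (Real.exp (-(φ x) / (2 * ε))))
    (by fun_prop)
    (ae_of_all _ fun x => by simp [Real.exp_pos]) (ae_of_all _ fun x => ENNReal.ofReal_ne_top)
  filter_upwards [hρ.ae_le h, Measure.rnDeriv_pos hρ,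
    hρ.ae_le (Measure.rnDeriv_lt_top ρ (volume.restrict Ω))] with x hx hpos htop
  rw [llr, hx, ENNReal.toReal_mul, ENNReal.toReal_inv, ENNReal.toReal_ofReal (Real.exp_pos _).le,
    Real.log_mul (inv_ne_zero (Real.exp_pos _).ne') 
    (ENNReal.toReal_pos hpos.ne' htop.ne).ne', Real.log_inv, Real.log_exp]
  ring

theorem absolutelyContinuous_gibbs (ε : ℝ) {Ω : Set (Pt d)} {φ : Pt d → ℝ} (hφ : Continuous φ) :
    volume.restrict Ω ≪
      (volume.restrict Ω).withDensity fun x => ENNReal.ofReal (Real.exp (-(φ x) / (2 * ε))) :=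
  have hmeas := hφ.measurable
  withDensity_absolutelyContinuous' (by fun_prop)
    (ae_of_all _ fun x => by simp [Real.exp_pos])

open InformationTheory in
/-- The entropy is the relative entropy with respect to the Gibbs measure minus the energy. -/
theorem boltzmann_eq_klDiv_sub {ε : ℝ} {Ω : Set (Pt d)} (hΩ : IsCompact Ω)
    {φ : Pt d → ℝ} (hφ : Continuous φ) {σ : Measure (Pt d)}
    (hσ : σ = (volume.restrict Ω).withDensity fun x =>
      ENNReal.ofReal (Real.exp (-(φ x) / (2 * ε)))) [IsProbabilityMeasure σ]
    {ρ : Measure (Pt d)} [IsProbabilityMeasure ρ] (hρ : ρ ≪ volume.restrict Ω)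
    (hfin : klDiv ρ σ ≠ ⊤) :
    boltzmann Ω ρ = (((klDiv ρ σ).toReal - (∫ x, φ x ∂ρ) / (2 * ε) : ℝ) : EReal) := by
  have hac : ρ ≪ σ := hρ.trans (hσ ▸ absolutelyContinuous_gibbs ε hφ)
  have hllr : llr ρ σ =ᵐ[ρ] fun x =>
      Real.log (ρ.rnDeriv (volume.restrict Ω) x).toReal + φ x / (2 * ε) :=
    hσ ▸ llr_gibbs_ae_eq ε hρ hφ
  have hint : Integrable (fun x => φ x / (2 * ε)) ρ :=
    (integrable_of_continuous_of_absolutelyContinuous hΩ hρ hφ).div_const _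
  have hlog : (fun x => llr ρ σ x - φ x / (2 * ε)) =ᵐ[ρ]
      fun x => Real.log (ρ.rnDeriv (volume.restrict Ω) x).toReal := by
    filter_upwards [hllr] with x hx
    rw [hx, add_sub_cancel_right]
  have hL := (klDiv_ne_top_iff.1 hfin).2
  rw [boltzmann, if_pos ⟨hρ, (hL.sub hint).congr hlog⟩, ← integral_congr_ae hlog,
    integral_sub hL hint, integral_div,
    toReal_klDiv_of_measure_eq hac (by rw [measure_univ, measure_univ])]

open InformationTheory in
theorem klDiv_ne_top_of_boltzmann_ne_top {ε : ℝ} {Ω : Set (Pt d)} (hΩ : IsCompact Ω)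
    {φ : Pt d → ℝ} (hφ : Continuous φ) {σ : Measure (Pt d)}
    (hσ : σ = (volume.restrict Ω).withDensity fun x =>
      ENNReal.ofReal (Real.exp (-(φ x) / (2 * ε))))
    {ρ : Measure (Pt d)} [IsProbabilityMeasure ρ] (hfin : boltzmann Ω ρ ≠ ⊤) :
    klDiv ρ σ ≠ ⊤ := by
  unfold boltzmann at hfin
  split_ifs at hfin with h
  · have hllr := llr_gibbs_ae_eq ε h.1 hφ
    rw [← hσ] at hllr
    exact klDiv_ne_top (h.1.trans (hσ ▸ absolutelyContinuous_gibbs ε hφ))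
      ((h.2.add ((integrable_of_continuous_of_absolutelyContinuous hΩ h.1 hφ).div_const _)).congr
        hllr.symm)
  · exact absurd rfl hfin

/-! ### The minimizer -/

open InformationTheory in
/-- The objective at `ρ` exceeds the constant `(1/N) ∑ ψᵢ / (2ε)` by at least the relative entropy of
`ρ` with respect to the Gibbs measure: weak duality, with the energies `∫ φ dρ` cancelling. -/
theorem le_moreauYosidaObjective [NeZero N] {ε : ℝ} (hε : 0 < ε) {Ω : Set (Pt d)}
    (hΩ : IsCompact Ω) {X : Fin N → Pt d} (hX : Function.Injective X) (ψ : Fin N → ℝ)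
    {σ : Measure (Pt d)} (hσ : σ = (volume.restrict Ω).withDensity fun x =>
      ENNReal.ofReal (Real.exp (-(dualPotential X ψ x) / (2 * ε)))) [IsProbabilityMeasure σ]
    {ρ : Measure (Pt d)} (hρ : ρ ∈ probAC Ω) (hfin : klDiv ρ σ ≠ ⊤) :
    ((1 / (N : ℝ) * (∑ i, ψ i) / (2 * ε) + (klDiv ρ σ).toReal : ℝ) : EReal) ≤
      moreauYosidaObjective ε Ω (empiricalMeasure X) ρ := by
  have := hρ.1
  have hφ := continuous_dualPotential X ψ
  have hint := integrable_of_continuous_of_absolutelyContinuous hΩ hρ.2 hφ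
  have hW := ofReal_dualValue_le_W2_sq (hρ.2.ae_le (ae_restrict_mem hΩ.measurableSet)) hX
    ⟨hint, fun x _ i => le_sub_iff_add_le.1 (dualPotential_le X ψ x i)⟩
  have hW' : ((dualValue ρ (dualPotential X ψ) ψ / (2 * ε) : ℝ) : EReal) ≤
      ((W2 ρ (empiricalMeasure X) ^ 2 / ENNReal.ofReal (2 * ε) : ℝ≥0∞) : EReal) := by
    refine le_trans ?_ (EReal.coe_ennreal_le_coe_ennreal_iff.2 (ENNReal.div_le_div_right hW _))
    rw [← ENNReal.ofReal_div_of_pos (by positivity), EReal.coe_ennreal_ofReal]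
    exact EReal.coe_le_coe_iff.2 (le_max_left _ _)
  rw [moreauYosidaObjective, boltzmann_eq_klDiv_sub hΩ hφ hσ hρ.2 hfin]
  refine le_trans (le_of_eq ?_) (add_le_add_left hW' _)
  rw [← EReal.coe_add, dualValue]
  congr 1
  ring

theorem isUniqueMinimizer_gibbs [NeZero N] {ε : ℝ} (hε : 0 < ε) {Ω : Set (Pt d)}
    (hΩ : IsCompact Ω) {X : Fin N → Pt d} (hX : Function.Injective X) (ψ : Fin N → ℝ)
    {σ : Measure (Pt d)} (hσ : σ = (volume.restrict Ω).withDensity fun x =>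
      ENNReal.ofReal (Real.exp (-(dualPotential X ψ x) / (2 * ε)))) [IsProbabilityMeasure σ]
    (hopt : IsOptimalPotentialPair Ω σ X (dualPotential X ψ) ψ) :
    IsUniqueMinimizer (moreauYosidaObjective ε Ω (empiricalMeasure X)) (probAC Ω) σ := by
  have hφ := continuous_dualPotential X ψ
  have hac : σ ≪ volume.restrict Ω := hσ ▸ withDensity_absolutelyContinuous _ _
  have hmem : σ ∈ probAC Ω := ⟨inferInstance, hac⟩
  have hself : InformationTheory.klDiv σ σ = 0 := InformationTheory.klDiv_self σ
  have hval : moreauYosidaObjective ε Ω (empiricalMeasure X) σ =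
      ((1 / (N : ℝ) * (∑ i, ψ i) / (2 * ε) : ℝ) : EReal) := by
    have hW : W2 σ (empiricalMeasure X) ^ 2 =
        ENNReal.ofReal (dualValue σ (dualPotential X ψ) ψ) := by
      rw [← EReal.toENNReal_coe (x := W2 σ (empiricalMeasure X) ^ 2), ← hopt.value_eq,
        EReal.toENNReal_of_ne_top (EReal.coe_ne_top _), EReal.toReal_coe]
    have hpos : 0 ≤ dualValue σ (dualPotential X ψ) ψ := by
      rw [← EReal.coe_nonneg, hopt.value_eq]
      exact EReal.coe_ennreal_nonneg _
    rw [moreauYosidaObjective, boltzmann_eq_klDiv_sub hΩ hφ hσ hac (by simp), hself, hW,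
      ← ENNReal.ofReal_div_of_pos (by positivity), EReal.coe_ennreal_ofReal,
      max_eq_left (by positivity), ← EReal.coe_add, dualValue, ENNReal.toReal_zero]
    congr 1
    ring
  refine ⟨hmem, fun ρ hρ => ?_, fun ρ hρ hmin => ?_⟩
  · change moreauYosidaObjective ε Ω (empiricalMeasure X) σ ≤ _
    have := hρ.1
    by_cases hfin : boltzmann Ω ρ = ⊤
    · rw [moreauYosidaObjective, moreauYosidaObjective, hfin,
        EReal.add_top_of_ne_bot (EReal.coe_ennreal_ne_bot _)]
      exact le_top
    · rw [hval]
      exact (EReal.coe_le_coe_iff.2 (le_add_of_nonneg_right ENNReal.toReal_nonneg)).trans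
        (le_moreauYosidaObjective hε hΩ hX ψ hσ hρ
          (klDiv_ne_top_of_boltzmann_ne_top hΩ hφ hσ hfin))
  · have := hρ.1
    have hle : moreauYosidaObjective ε Ω (empiricalMeasure X) ρ ≤
        moreauYosidaObjective ε Ω (empiricalMeasure X) σ := hmin hmem
    rw [hval] at hle
    have hfin : boltzmann Ω ρ ≠ ⊤ := by
      intro h
      rw [moreauYosidaObjective, h,
        EReal.add_top_of_ne_bot (EReal.coe_ennreal_ne_bot _)] at hle
      exact (EReal.coe_ne_top _) (top_le_iff.1 hle)
    have hkl := klDiv_ne_top_of_boltzmann_ne_top hΩ hφ hσ hfin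
    have h := EReal.coe_le_coe_iff.1
      ((le_moreauYosidaObjective hε hΩ hX ψ hσ hρ hkl).trans hle)
    have hzero : (InformationTheory.klDiv ρ σ).toReal = 0 :=
      le_antisymm (by linarith) ENNReal.toReal_nonneg
    exact InformationTheory.klDiv_eq_zero_iff.1
      (((ENNReal.toReal_eq_zero_iff _).1 hzero).resolve_right hkl)

end SemiDiscreteOT

theorem proposition5p3 {d N : ℕ} (hN : 0 < N) (ε : ℝ) (hε : 0 < ε)
    (Ω : Set (SemiDiscreteOT.Pt d)) (hΩ : IsCompact Ω) (hΩpos : 0 < volume Ω)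
    (X : Fin N → SemiDiscreteOT.Pt d) (hX : X ∉ SemiDiscreteOT.generalizedDiagonal d N) :
    (∃ ψ : Fin N → ℝ, ∀ i,
      ∫ x in SemiDiscreteOT.laguerreCell Ω X ψ i,
        Real.exp (-(‖x - X i‖ ^ 2 - ψ i) / (2 * ε)) = 1 / (N : ℝ)) ∧
    ∀ ψ : Fin N → ℝ,
      (∀ i, ∫ x in SemiDiscreteOT.laguerreCell Ω X ψ i,
        Real.exp (-(‖x - X i‖ ^ 2 - ψ i) / (2 * ε)) = 1 / (N : ℝ)) →
      ∀ φ : SemiDiscreteOT.Pt d → ℝ, φ = SemiDiscreteOT.dualPotential X ψ →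
      ∀ σ : SemiDiscreteOT.Pt d → ℝ, σ = SemiDiscreteOT.gibbsDensity ε Ω φ →
        SemiDiscreteOT.IsUniqueMinimizer
          (SemiDiscreteOT.moreauYosidaObjective ε Ω (SemiDiscreteOT.empiricalMeasure X))
          (SemiDiscreteOT.probAC Ω) (SemiDiscreteOT.measureOfDensity σ) ∧
        (∀ x ∈ Ω, φ x / (2 * ε) + Real.log (σ x) = 0) ∧
        SemiDiscreteOT.IsOptimalPotentialPair Ω (SemiDiscreteOT.measureOfDensity σ) X φ ψ := by
  have : NeZero N := ⟨hN.ne'⟩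
  have hinj : Function.Injective X := fun i j hij => by
    by_contra hne
    exact hX ⟨i, j, hne, hij⟩
  refine ⟨SemiDiscreteOT.exists_forall_setIntegral_laguerreCell_eq hε hΩ hΩpos hinj, ?_⟩
  rintro ψ hψ φ rfl σ rfl
  have hφ := SemiDiscreteOT.continuous_dualPotential X ψ
  have hσ := SemiDiscreteOT.measureOfDensity_gibbsDensity ε hΩ.measurableSet
    (SemiDiscreteOT.dualPotential X ψ)
  have hmass := fun i => SemiDiscreteOT.measureOfDensity_gibbsDensity_laguerreCell ε hΩ (hψ i)
  have hac : SemiDiscreteOT.measureOfDensity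
      (SemiDiscreteOT.gibbsDensity ε Ω (SemiDiscreteOT.dualPotential X ψ)) ≪
        volume.restrict Ω := by
    rw [hσ]
    exact withDensity_absolutelyContinuous _ _
  have hprob := SemiDiscreteOT.isProbabilityMeasure_of_laguerreCell hΩ.measurableSet hac hinj hmass
  have hopt := SemiDiscreteOT.isOptimalPotentialPair_dualPotential hΩ hac hinj hmass
    (SemiDiscreteOT.integrable_of_continuous_of_absolutelyContinuous hΩ hac hφ)
  refine ⟨SemiDiscreteOT.isUniqueMinimizer_gibbs hε hΩ hinj ψ hσ hopt, fun x hx => ?_, hopt⟩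
  rw [SemiDiscreteOT.log_gibbsDensity _ hx]
  ring
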